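/- Let $p,\delta,\epsilon\in[0,1]$. Consider the three-user interference channel with feedback in which all the variables below take values in $\{0,1\}$, transmitters $1,2,3$ send $(X_{11},X_{12})$, $X_2$ and $(X_{32},X_{33})$ respectively, and receivers $1,2,3$ observe $Y_1$, $(Y_2,Y_2')$ and $Y_3$ respectively, where $$Y_1=X_{11}\oplus N_p,\qquad Y_2=X_2\oplus N_p,\qquad Y_2'=X_{12}\oplus N_\delta\oplus\big((X_{12}\oplus X_{32})\wedge E\big),\qquad Y_3=X_{33}\oplus N_p\oplus N_\epsilon .$$ Here $\oplus$ is addition modulo $2$, and $N_p,N_\delta,N_\epsilon,E$ are mutually independent Bernoulli random variables with $P(N_p=1)=p$, $P(N_\delta=1)=\delta$, $P(N_\epsilon=1)=\epsilon$, $P(E=1)=\tfrac12$, drawn independently in each channel use. Transmitters $1$ and $3$ receive the noiseless feedback $Z_1=Y_1$ and $Z_3=Y_3$ with unit delay, and transmitter $2$ receives no feedback. For positive integers $M_1,M_2,M_3,N$, a code consists of encoding functions $f_{i,n}:\{1,\dots,M_i\}\times\mathcal Z_i^{n-1}\to\mathcal X_i$ ($1\le n\le N$) and decoding functions $g_i:\mathcal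 Y_i^N\to\{1,\dots,M_i\}$, $i\in\{1,2,3\}$, where $\mathcal X_i,\mathcal Y_i,\mathcal Z_i$ are the input, output and feedback alphabets of user $i$. For independent, uniformly distributed messages $W_1,W_2,W_3$, let $P_e$ be the probability that at least one message is decoded incorrectly. For $\eta>0$, a triple $(R_1,R_2,R_3)\in\mathbb R^3$ is $\eta$-achievable by the code if $P_e\le\eta$ and $\frac1N\log_2 M_i\ge R_i-\eta$ for $i=1,2,3$. It is $\eta$-achievable if it is $\eta$-achievable by some code (with some $M_1,M_2,M_3,N$), or by some randomized coding strategy, that is, a probability measure on the encoding functions such that with probability one there are decoding functions which, together with the chosen encoding functions, form a code by which the triple is $\eta$-achievable. The feedback-capacity region $\mathcal C_\epsilon$ is the set of all triples in $\mathbb R^3$ that are $\eta$-achievable for every $\eta>0$. Then, for any $p,\delta\in[0,1]$ and any $(R_1,R_2,R_3)\in\mathcal C_0$, there exist a continuous function $\zeta:\mathbb R\to\mathbb R$ with $\zeta(\epsilon)\to0$ as $\epsilon\to0^+$ and an $\epsilon_0>0$ such that, for all $\epsilon\in[0,1]$ with $0<\epsilon<\epsilon_0$, $$(R_1-\zeta(\epsilon),\,R_2-\zeta(\epsilon),\,R_3-\zeta(\epsilon))\in\mathcal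 C_\epsilon .$$ -/

import Mathlib

open Filter Topology

noncomputable section

/-- A three-user interference channel with (generalized) feedback, with finite alphabets.
Users are indexed by `Fin 3`. `Q x y` is the probability `Q(y | x)` of the output triple `y` given
the input triple `x`, and `P y z` is the probability `P(z | y)` of the feedback triple `z` given the
output triple `y`. -/
structure ICFB where
  /-- input alphabets -/
  X : Fin 3 → Type
  /-- output alphabets -/
  Y : Fin 3 → Type
  /-- feedback alphabets -/
  Z : Fin 3 → Type
  [fintypeX : ∀ i, Fintype (X i)]
  [fintypeY : ∀ i, Fintype (Y i)]
  [fintypeZ : ∀ i, Fintype (Z i)]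
  Q : (∀ i, X i) → (∀ i, Y i) → ℝ
  Q_nonneg : ∀ x y, 0 ≤ Q x y
  Q_sum : ∀ x, ∑ y, Q x y = 1
  P : (∀ i, Y i) → (∀ i, Z i) → ℝ
  P_nonneg : ∀ y z, 0 ≤ P y z
  P_sum : ∀ y, ∑ z, P y z = 1

namespace ICFB

attribute [instance] ICFB.fintypeX ICFB.fintypeY ICFB.fintypeZ

/-- The three sequences of encoding functions of a code with `M i` messages for user `i` and
blocklength `N`. At time `n` (times are `0, …, N - 1`) encoder `i` sees its message and the `n`
feedback symbols it received at the earlier times. -/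
def Encoder (ch : ICFB) (M : Fin 3 → ℕ) (N : ℕ) : Type :=
  ∀ i : Fin 3, Fin (M i) → ∀ n : Fin N, (Fin (n : ℕ) → ch.Z i) → ch.X i

/-- The three decoding functions: decoder `i` sees the whole output block of user `i`. -/
def Decoder (ch : ICFB) (M : Fin 3 → ℕ) (N : ℕ) : Type :=
  ∀ i : Fin 3, (Fin N → ch.Y i) → Fin (M i)

/-- The input triple at time `n`, for messages `w` and feedback sequences `z`. It depends only on
the feedback symbols at times before `n`. -/
def input (ch : ICFB) {M : Fin 3 → ℕ} {N : ℕ} (f : ch.Encoder M N) (w : ∀ i, Fin (M i))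
    (z : Fin N → ∀ i, ch.Z i) (n : Fin N) : ∀ i, ch.X i :=
  fun i => f i (w i) n (fun k => z (k.castLE n.isLt.le) i)

/-- The joint probability of messages `w`, outputs `y` and feedback `z`: the messages are
independent and uniform, and the channel is memoryless. -/
def jointProb (ch : ICFB) {M : Fin 3 → ℕ} {N : ℕ} (f : ch.Encoder M N) (w : ∀ i, Fin (M i))
    (y : Fin N → ∀ i, ch.Y i) (z : Fin N → ∀ i, ch.Z i) : ℝ :=
  (∏ i, (1 / (M i : ℝ))) * ∏ n, (ch.Q (ch.input f w z n) (y n) * ch.P (y n) (z n))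

open Classical in
/-- The probability that at least one of the three messages is decoded incorrectly. -/
def errorProb (ch : ICFB) {M : Fin 3 → ℕ} {N : ℕ} (f : ch.Encoder M N) (g : ch.Decoder M N) : ℝ :=
  ∑ w : ∀ i, Fin (M i), ∑ y : Fin N → ∀ i, ch.Y i, ∑ z : Fin N → ∀ i, ch.Z i,
    if (fun i => g i (fun n => y n i)) ≠ w then ch.jointProb f w y z else 0

/-- The rate triple `R` is `η`-achievable by the feedback-block-code `(f, g)`. Rates are in bits
per channel use. -/
def AchievableBy (ch : ICFB) (η : ℝ) (R : Fin 3 → ℝ) {M : Fin 3 → ℕ} {N : ℕ}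
    (f : ch.Encoder M N) (g : ch.Decoder M N) : Prop :=
  ch.errorProb f g ≤ η ∧ ∀ i, R i - η ≤ 1 / (N : ℝ) * Real.logb 2 (M i)

/-- The rate triple `R` is `η`-achievable by the randomized coding strategy `μ`, a probability
measure on the encoding functions: with probability one there are decoders which, with the chosen
encoding functions, form a code by which `R` is `η`-achievable. -/
def AchievableByRandomized (ch : ICFB) (η : ℝ) (R : Fin 3 → ℝ) {M : Fin 3 → ℕ} {N : ℕ}
    (μ : PMF (ch.Encoder M N)) : Prop :=
  ∀ f ∈ μ.support, ∃ g : ch.Decoder M N, ch.AchievableBy η R f g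

/-- The rate triple `R` is `η`-achievable: by a feedback-block-code or by a randomized coding
strategy, with some positive numbers of messages and some positive blocklength. -/
def EpsAchievable (ch : ICFB) (η : ℝ) (R : Fin 3 → ℝ) : Prop :=
  ∃ (M : Fin 3 → ℕ) (N : ℕ), (∀ i, 0 < M i) ∧ 0 < N ∧
    ((∃ (f : ch.Encoder M N) (g : ch.Decoder M N), ch.AchievableBy η R f g) ∨
      ∃ μ : PMF (ch.Encoder M N), ch.AchievableByRandomized η R μ)

/-- The feedback-capacity region: all rate triples that are `η`-achievable for every `η > 0`. -/
def feedbackCapacity (ch : ICFB) : Set (Fin 3 → ℝ) :=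
  {R | ∀ η : ℝ, 0 < η → ch.EpsAchievable η R}

end ICFB

namespace Example1

/-- Input alphabets: `(X₁₁, X₁₂)`, `X₂`, `(X₃₂, X₃₃)`. All components are binary. -/
def In : Fin 3 → Type
  | 0 => Bool × Bool
  | 1 => Bool
  | 2 => Bool × Bool

/-- Output alphabets: `Y₁`, `(Y₂, Y₂')`, `Y₃`. All components are binary. -/
def Out : Fin 3 → Type
  | 0 => Bool
  | 1 => Bool × Bool
  | 2 => Bool

/-- Feedback alphabets: `Z₁ = Y₁`, no feedback at transmitter 2, `Z₃ = Y₃`. -/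
def Fb : Fin 3 → Type
  | 0 => Bool
  | 1 => Unit
  | 2 => Bool

instance instFintypeIn : ∀ i, Fintype (In i)
  | 0 => inferInstanceAs (Fintype (Bool × Bool))
  | 1 => inferInstanceAs (Fintype Bool)
  | 2 => inferInstanceAs (Fintype (Bool × Bool))

instance instFintypeOut : ∀ i, Fintype (Out i)
  | 0 => inferInstanceAs (Fintype Bool)
  | 1 => inferInstanceAs (Fintype (Bool × Bool))
  | 2 => inferInstanceAs (Fintype Bool)

instance instFintypeFb : ∀ i, Fintype (Fb i)
  | 0 => inferInstanceAs (Fintype Bool)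
  | 1 => inferInstanceAs (Fintype Unit)
  | 2 => inferInstanceAs (Fintype Bool)

/-- A realization of the channel noise. -/
structure Noise where
  np : Bool
  nδ : Bool
  nε : Bool
  e : Bool

/-- A realization of the noise as a tuple of bits. -/
def noiseEquiv : (Bool × Bool × Bool × Bool) ≃ Noise where
  toFun b := ⟨b.1, b.2.1, b.2.2.1, b.2.2.2⟩
  invFun v := (v.np, v.nδ, v.nε, v.e)
  left_inv _ := rfl
  right_inv _ := rfl

instance instFintypeNoise : Fintype Noise := Fintype.ofEquiv _ noiseEquiv

/-- The Bernoulli probability mass function with parameter `q`. -/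
def bern (q : ℝ) (b : Bool) : ℝ := if b then q else 1 - q

/-- The law of the noise: independent Bernoulli variables `N_p`, `N_δ`, `N_ε`, `E` with parameters
`p`, `δ`, `ε`, `1/2`. -/
def noiseProb (p δ ε : ℝ) (v : Noise) : ℝ :=
  bern p v.np * bern δ v.nδ * bern ε v.nε * bern (1 / 2) v.e

/-- The channel outputs, as a function of the inputs and of the noise:
`Y₁ = X₁₁ ⊕ N_p`, `Y₂ = X₂ ⊕ N_p`, `Y₂' = X₁₂ ⊕ N_δ ⊕ ((X₁₂ ⊕ X₃₂) ∧ E)`,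
`Y₃ = X₃₃ ⊕ N_p ⊕ N_ε`. -/
def output (x : ∀ i, In i) (v : Noise) : ∀ i, Out i :=
  let x1 : Bool × Bool := x 0
  let x2 : Bool := x 1
  let x3 : Bool × Bool := x 2
  fun
  | 0 => (xor x1.1 v.np : Bool)
  | 1 => ((xor x2 v.np, xor (xor x1.2 v.nδ) (xor x1.2 x3.1 && v.e)) : Bool × Bool)
  | 2 => (xor (xor x3.2 v.np) v.nε : Bool)

/-- The noiseless feedback `Z₁ = Y₁`, `Z₃ = Y₃`, with trivial `Z₂`. -/
def feedback (y : ∀ i, Out i) : ∀ i, Fb i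
  | 0 => y 0
  | 1 => ()
  | 2 => y 2

theorem bern_nonneg (q : unitInterval) (b : Bool) : 0 ≤ bern q b := by
  have h0 := q.2.1
  have h1 := q.2.2
  unfold bern
  split_ifs <;> linarith

theorem noiseProb_nonneg (p δ ε : unitInterval) (v : Noise) : 0 ≤ noiseProb p δ ε v := by
  have h : 0 ≤ bern (1 / 2) v.e := by
    unfold bern
    split_ifs <;> norm_num
  exact mul_nonneg (mul_nonneg (mul_nonneg (bern_nonneg p _) (bern_nonneg δ _))
    (bern_nonneg ε _)) h

theorem noiseProb_sum (p δ ε : ℝ) : ∑ v, noiseProb p δ ε v = 1 := by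
  rw [← noiseEquiv.sum_comp]
  simp only [Fintype.sum_prod_type, Fintype.sum_bool, noiseProb, noiseEquiv, bern,
    Equiv.coe_fn_mk, if_true]
  simp
  ring

open Classical in
/-- The interference channel with feedback of the example, for noise parameters `p`, `δ`, `ε`. -/
def channel (p δ ε : unitInterval) : ICFB where
  X := In
  Y := Out
  Z := Fb
  Q x y := ∑ v : Noise, if output x v = y then noiseProb p δ ε v else 0
  Q_nonneg x y := Finset.sum_nonneg fun v _ => by
    split_ifs
    · exact noiseProb_nonneg p δ ε v
    · exact le_rfl
  Q_sum x := by
    rw [Finset.sum_comm]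
    simp [noiseProb_sum]
  P y z := if feedback y = z then 1 else 0
  P_nonneg y z := by
    split_ifs <;> norm_num
  P_sum y := by simp

end Example1

end

/-!
A code for the channel with `ε = 0` has an error probability that is a polynomial in the transition
probabilities, so it remains a code of small, but not vanishing, error probability `η` for all
nearby channels. Using it as the inner code of a concatenated code makes the error probability
vanish: the outer codes have relative distance `4 * η`, while after a random shift of the outer
codewords the inner decoding errors in the `L` blocks are independent events of probability at most
`η`, so that having `2 * η * L` of them is exponentially unlikely. By the Gilbert–Varshamov bound
the rates of the outer codes cost only a loss that tends to `0` with `η`. Thus every fixed loss `c`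
is attained for all small enough `ε`, and the thresholds for `c = 2⁻ᵏ` are interpolated by a
continuous function `ζ`.
-/

open scoped BigOperators

section Causal

variable {S A : Type*} [Fintype S] [CommSemiring A]

theorem sum_prod_eq_one_of_causal {N : ℕ} (q : ∀ n : Fin N, (Fin (n : ℕ) → S) → S → A)
    (hq : ∀ n h, ∑ s, q n h s = 1) :
    ∑ s : Fin N → S, ∏ n, q n (fun k => s (k.castLE n.isLt.le)) (s n) = 1 := by
  induction N with
  | zero => simp
  | succ N ih =>
    have prod_snoc (t : Fin N → S) (a : S) :
        ∏ n : Fin (N + 1), q n (fun k => Fin.snoc (α := fun _ => S) t a (k.castLE n.isLt.le))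
            (Fin.snoc (α := fun _ => S) t a n) =
          (∏ n : Fin N, q n.castSucc (fun k => t (k.castLE n.isLt.le)) (t n)) *
            q (Fin.last N) t a := by
      have past (n : Fin (N + 1)) (k : Fin n) :
          Fin.snoc (α := fun _ => S) t a (k.castLE n.isLt.le) =
            t (k.castLE (Nat.lt_succ_iff.1 n.isLt)) :=
        Fin.snoc_castSucc (α := fun _ => S) a t (k.castLE (Nat.lt_succ_iff.1 n.isLt))
      rw [Fin.prod_univ_castSucc]
      simp only [past, Fin.snoc_castSucc, Fin.snoc_last]
      rfl
    calc ∑ s : Fin (N + 1) → S, ∏ n, q n (fun k => s (k.castLE n.isLt.le)) (s n)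
        = ∑ t : Fin N → S, ∑ a,
            (∏ n : Fin N, q n.castSucc (fun k => t (k.castLE n.isLt.le)) (t n)) *
              q (Fin.last N) t a := by
          rw [← (Fin.snocEquiv fun _ => S).sum_comp, Fintype.sum_prod_type, Finset.sum_comm]
          exact Finset.sum_congr rfl fun t _ => Finset.sum_congr rfl fun a _ => prod_snoc t a
      _ = ∑ t : Fin N → S, ∏ n : Fin N, q n.castSucc (fun k => t (k.castLE n.isLt.le)) (t n) := by
          simp only [← Finset.mul_sum, hq, mul_one]
      _ = 1 := ih (fun n => q n.castSucc) fun n => hq n.castSucc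

end Causal

section Hamming

variable {ι α : Type*} [Fintype ι] [DecidableEq α]

theorem pow_hammingDist_eq_prod {A : Type*} [CommMonoid A] (a : A) (x y : ι → α) :
    a ^ hammingDist x y = ∏ i, if x i ≠ y i then a else 1 := by
  simp [Finset.prod_ite, hammingDist]

theorem exists_nearest_codeword_decoder {β : Type*} [Nonempty β] {r : ℝ} {c : β → ι → α}
    (hc : Pairwise fun m m' => 2 * r ≤ (hammingDist (c m) (c m') : ℝ)) :
    ∃ dec : (ι → α) → β, ∀ m v, (hammingDist v (c m) : ℝ) < r → dec v = m := by
  have unique_of_lt {v m m'} (hm : (hammingDist v (c m) : ℝ) < r)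
      (hm' : (hammingDist v (c m') : ℝ) < r) : m = m' := by
    by_contra hne
    have htri : (hammingDist (c m) (c m') : ℝ) ≤ hammingDist v (c m) + hammingDist v (c m') :=
      mod_cast hammingDist_triangle_left (c m) (c m') v
    linarith [hc hne]
  have (v : ι → α) : ∃ m', ∀ m, (hammingDist v (c m) : ℝ) < r → m' = m := by
    by_cases h : ∃ m', (hammingDist v (c m') : ℝ) < r
    · exact h.imp fun m' hm' m => unique_of_lt hm'
    · exact ⟨Classical.arbitrary β, fun m hm => (h ⟨m, hm⟩).elim⟩
  choose dec hdec using this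
  exact ⟨dec, fun m v => hdec v m⟩

theorem exists_maximal_hammingDist_separated [Finite α] {r : ℝ} (hr : 0 < r) :
    ∃ S : Finset (ι → α), (S : Set (ι → α)).Pairwise (fun x y => r ≤ (hammingDist x y : ℝ)) ∧
      ∀ x, ∃ y ∈ S, (hammingDist x y : ℝ) < r := by
  classical
  obtain ⟨S, hS⟩ := Set.Finite.exists_maximal (α := Finset (ι → α))
    (s := {S | (S : Set (ι → α)).Pairwise fun x y => r ≤ (hammingDist x y : ℝ)})
    (Set.toFinite _) ⟨∅, by simp⟩
  refine ⟨S, hS.prop, fun x => ?_⟩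
  by_contra! hx
  have insert_mem : (insert x S : Finset _) ∈
      {S : Finset (ι → α) | (S : Set (ι → α)).Pairwise fun x y => r ≤ (hammingDist x y : ℝ)} := by
    rw [Set.mem_ofPred_eq, Finset.coe_insert]
    exact hS.prop.insert fun y hy _ => ⟨hx y hy, hammingDist_comm x y ▸ hx y hy⟩
  have hxS : x ∈ S := hS.le_of_ge insert_mem (Finset.subset_insert x S) (Finset.mem_insert_self x S)
  have := hx x hxS
  rw [hammingDist_self, Nat.cast_zero] at this
  exact this.not_gt hr

variable [Fintype α]

theorem sum_pow_hammingDist [DecidableEq ι] {A : Type*} [CommRing A] (a : A) (y : ι → α) :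
    ∑ x : ι → α, a ^ hammingDist x y =
      (1 + ((Fintype.card α : A) - 1) * a) ^ Fintype.card ι := by
  have letter (i : ι) :
      ∑ b : α, (if b ≠ y i then a else 1) = 1 + ((Fintype.card α : A) - 1) * a := by
    have (b : α) : (if b ≠ y i then a else 1) = (if b = y i then 1 - a else 0) + a := by
      split_ifs <;> simp_all
    simp only [this, Finset.sum_add_distrib, Finset.sum_ite_eq', Finset.mem_univ, if_true,
      Finset.sum_const, Finset.card_univ, nsmul_eq_mul]
    ring
  calc ∑ x : ι → α, a ^ hammingDist x y
      = ∑ x : ι → α, ∏ i, (if x i ≠ y i then a else 1) := by simp only [pow_hammingDist_eq_prod]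
    _ = ∏ i, ∑ b, (if b ≠ y i then a else 1) :=
        (Fintype.prod_sum fun i b => if b ≠ y i then a else 1).symm
    _ = (1 + ((Fintype.card α : A) - 1) * a) ^ Fintype.card ι := by
        simp only [letter, Finset.prod_const, Finset.card_univ]

theorem card_hammingBall_le [DecidableEq ι] {s : ℝ} (hs : 0 < s) (hs1 : s ≤ 1) (r : ℝ) (y : ι → α) :
    (({x : ι → α | (hammingDist x y : ℝ) < r} : Finset _).card : ℝ) ≤
      (1 + ((Fintype.card α : ℝ) - 1) * s) ^ Fintype.card ι * s ^ (-r) := by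
  have one_le (x : ι → α) (hx : (hammingDist x y : ℝ) < r) :
      1 ≤ s ^ hammingDist x y * s ^ (-r) := by
    rw [← Real.rpow_natCast, ← Real.rpow_add hs]
    exact Real.one_le_rpow_of_pos_of_le_one_of_nonpos hs hs1 (by linarith)
  calc (({x : ι → α | (hammingDist x y : ℝ) < r} : Finset _).card : ℝ)
      = ∑ x : ι → α with (hammingDist x y : ℝ) < r, (1 : ℝ) := by simp
    _ ≤ ∑ x : ι → α with (hammingDist x y : ℝ) < r, s ^ hammingDist x y * s ^ (-r) :=
        Finset.sum_le_sum fun x hx => one_le x (Finset.mem_filter.1 hx).2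
    _ ≤ ∑ x : ι → α, s ^ hammingDist x y * s ^ (-r) :=
        Finset.sum_le_sum_of_subset_of_nonneg (Finset.filter_subset _ _)
          fun x _ _ => by positivity
    _ = (1 + ((Fintype.card α : ℝ) - 1) * s) ^ Fintype.card ι * s ^ (-r) := by
        rw [← Finset.sum_mul, sum_pow_hammingDist]

theorem exists_gilbert_varshamov_code {s : ℝ} (hs : 0 < s) (hs1 : s ≤ 1) {r : ℝ} (hr : 0 < r) :
    ∃ S : Finset (ι → α), (S : Set (ι → α)).Pairwise (fun x y => r ≤ (hammingDist x y : ℝ)) ∧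
      (Fintype.card α : ℝ) ^ Fintype.card ι ≤
        S.card * ((1 + ((Fintype.card α : ℝ) - 1) * s) ^ Fintype.card ι * s ^ (-r)) := by
  classical
  obtain ⟨S, hS, hcover⟩ := exists_maximal_hammingDist_separated (ι := ι) (α := α) hr
  refine ⟨S, hS, ?_⟩
  have univ_subset : (Finset.univ : Finset (ι → α)) ⊆
      S.biUnion fun y => {x : ι → α | (hammingDist x y : ℝ) < r} := fun x _ => by
    simpa using hcover x
  calc (Fintype.card α : ℝ) ^ Fintype.card ι
      = ((Finset.univ : Finset (ι → α)).card : ℝ) := by simp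
    _ ≤ ∑ y ∈ S, (({x : ι → α | (hammingDist x y : ℝ) < r} : Finset _).card : ℝ) :=
        mod_cast (Finset.card_le_card univ_subset).trans Finset.card_biUnion_le
    _ ≤ S.card * ((1 + ((Fintype.card α : ℝ) - 1) * s) ^ Fintype.card ι * s ^ (-r)) := by
        rw [← nsmul_eq_mul]
        exact Finset.sum_le_card_nsmul _ _ _ fun y _ => card_hammingBall_le hs hs1 r y

end Hamming

section Rate

/-- The rate, in bits per letter, that the Gilbert–Varshamov bound guarantees for codes of relative
distance `τ` over an alphabet of `2 ^ ρ` letters; it is slightly weakened, the exact bound having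
the binary entropy of `τ` in place of `logb 2 (1 + τ) - τ * logb 2 τ`. -/
noncomputable def gilbertVarshamovRate (τ ρ : ℝ) : ℝ :=
  (1 - τ) * ρ + τ * Real.logb 2 τ - Real.logb 2 (1 + τ)

theorem gilbertVarshamovRate_mono {τ : ℝ} (hτ1 : τ ≤ 1) : Monotone (gilbertVarshamovRate τ) :=
  fun ρ ρ' h => by
    have := mul_le_mul_of_nonneg_left h (sub_nonneg.2 hτ1)
    unfold gilbertVarshamovRate
    linarith

theorem gilbertVarshamovRate_mul_le {τ : ℝ} (hτ : 0 ≤ τ) (hτ1 : τ ≤ 1) {a : ℝ}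
    (ha1 : a ≤ 1) (ρ : ℝ) : gilbertVarshamovRate τ (a * ρ) ≤ a * gilbertVarshamovRate τ ρ := by
  have h1 : τ * Real.logb 2 τ ≤ 0 :=
    mul_nonpos_of_nonneg_of_nonpos hτ (Real.logb_nonpos one_lt_two hτ hτ1)
  have h2 : 0 ≤ Real.logb 2 (1 + τ) := Real.logb_nonneg one_lt_two (by linarith)
  unfold gilbertVarshamovRate
  nlinarith

theorem continuousAt_gilbertVarshamovRate_zero (ρ : ℝ) :
    ContinuousAt (fun p : ℝ × ℝ => gilbertVarshamovRate p.1 p.2) (0, ρ) := by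
  have hlog : ContinuousAt (fun p : ℝ × ℝ => Real.log (1 + p.1)) (0, ρ) :=
    ContinuousAt.log (by fun_prop) (by norm_num)
  have hmul_log : ContinuousAt (fun p : ℝ × ℝ => p.1 * Real.log p.1) (0, ρ) :=
    (Real.continuous_mul_log.comp continuous_fst).continuousAt
  simp only [gilbertVarshamovRate, Real.logb, ← mul_div_assoc]
  exact (ContinuousAt.add (by fun_prop) (hmul_log.div_const _)).sub (hlog.div_const _)

theorem eventually_lt_gilbertVarshamovRate {ρ ρ' : ℝ} (h : ρ' < ρ) :
    ∀ᶠ η in 𝓝[>] (0 : ℝ), ρ' < gilbertVarshamovRate (4 * η) (ρ - η) := by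
  have hcont : ContinuousAt (fun η : ℝ => gilbertVarshamovRate (4 * η) (ρ - η)) 0 :=
    ContinuousAt.comp (f := fun η : ℝ => (4 * η, ρ - η))
      (g := fun p : ℝ × ℝ => gilbertVarshamovRate p.1 p.2)
      (by simpa using continuousAt_gilbertVarshamovRate_zero ρ) (by fun_prop)
  refine (hcont.eventually (lt_mem_nhds ?_)).filter_mono nhdsWithin_le_nhds
  simpa [gilbertVarshamovRate] using h

theorem exists_codebook_gilbertVarshamovRate_le {α : Type*} [Fintype α] [DecidableEq α]
    [Nonempty α] {τ : ℝ} (hτ : 0 < τ) (hτ1 : τ ≤ 1) {n : ℕ} (hn : 0 < n) :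
    ∃ (K : ℕ) (c : Fin K → Fin n → α), 0 < K ∧
      (Pairwise fun m m' => τ * n ≤ (hammingDist (c m) (c m') : ℝ)) ∧
      n * gilbertVarshamovRate τ (Real.logb 2 (Fintype.card α)) ≤ Real.logb 2 K := by
  set q : ℝ := (Fintype.card α : ℝ)
  have hq : 1 ≤ q := Nat.one_le_cast.2 Fintype.card_pos
  have hs : 0 < τ / q := by positivity
  have hs1 : τ / q ≤ 1 := div_le_one_of_le₀ (hτ1.trans hq) (by positivity)
  have hbase : 1 + (q - 1) * (τ / q) ≤ 1 + τ := by
    have : q * (τ / q) = τ := mul_div_cancel₀ τ (by positivity)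
    linarith
  have hbase_pos : 0 < 1 + (q - 1) * (τ / q) := by nlinarith
  obtain ⟨S, hS, hcard⟩ :=
    exists_gilbert_varshamov_code (ι := Fin n) (α := α) hs hs1 (r := τ * n) (by positivity)
  rw [Fintype.card_fin] at hcard
  have hSpos : 0 < (S.card : ℝ) := by
    refine pos_of_mul_pos_left (lt_of_lt_of_le (by positivity) hcard) (by positivity)
  refine ⟨S.card, fun m => S.equivFin.symm m, mod_cast hSpos, fun m m' hne =>
    hS (Subtype.prop _) (Subtype.prop _) fun h =>
      hne (S.equivFin.symm.injective (Subtype.ext h)), ?_⟩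
  have hlog : n * Real.logb 2 q ≤ Real.logb 2 S.card + n * Real.logb 2 (1 + τ)
      - τ * n * (Real.logb 2 τ - Real.logb 2 q) := by
    calc n * Real.logb 2 q = Real.logb 2 (q ^ n) := (Real.logb_pow 2 q n).symm
      _ ≤ Real.logb 2 (S.card * ((1 + τ) ^ n * (τ / q) ^ (-(τ * n)))) :=
          Real.logb_le_logb_of_le one_lt_two (by positivity) (hcard.trans (by gcongr))
      _ = _ := by
          rw [Real.logb_mul hSpos.ne' (by positivity), Real.logb_mul (by positivity)
            (by positivity), Real.logb_pow, Real.logb_rpow_eq_mul_logb_of_pos hs,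
            Real.logb_div hτ.ne' (by positivity)]
          ring
  unfold gilbertVarshamovRate
  linarith

theorem two_rpow_neg_two_mul_mul_one_add_lt_one {η : ℝ} (hη : 0 < η) :
    (2 : ℝ) ^ (-(2 * η)) * (1 + η) < 1 := by
  have : 1 + η < 2 ^ (2 * η) := by
    calc 1 + η < Real.exp η := by linarith [Real.add_one_lt_exp hη.ne']
      _ ≤ Real.exp (Real.log 2 * (2 * η)) :=
          Real.exp_le_exp.2 (by nlinarith [Real.log_two_gt_d9])
      _ = 2 ^ (2 * η) := (Real.rpow_def_of_pos two_pos _).symm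
  rwa [Real.rpow_neg two_pos.le, inv_mul_lt_one₀ (by positivity)]

end Rate

section Averaging

theorem exists_shift_expect_le {G W : Type*} [AddGroup G] [Fintype G] [Fintype W] [Nonempty W]
    (F : G → ℝ) (c : W → G) : ∃ x, 𝔼 w, F (c w + x) ≤ 𝔼 u, F u := by
  have expect_shift (w : W) : 𝔼 x, F (c w + x) = 𝔼 u, F u :=
    Fintype.expect_equiv (Equiv.addLeft (c w)) _ _ fun _ => rfl
  have average : 𝔼 x, 𝔼 w, F (c w + x) = 𝔼 u, F u := by
    rw [Finset.expect_comm]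
    simp only [expect_shift, Fintype.expect_const]
  obtain ⟨x, -, hx⟩ := Finset.exists_le_of_expect_le Finset.univ_nonempty average.le
  exact ⟨x, hx⟩

variable {U O : Type*} [Fintype O] [DecidableEq U]

/-- The probability that, in `n` independent uses of a channel with transition probabilities
`κ u o` and with the inputs `u`, at least `r` of the `n` inputs are estimated incorrectly when
each of them is estimated by `φ` from its own output. -/
noncomputable def tailErrorProb (κ : U → O → ℝ) (φ : O → U) (r : ℝ) {n : ℕ} (u : Fin n → U) : ℝ :=
  ∑ o : Fin n → O, if r ≤ (hammingDist (fun b => φ (o b)) u : ℝ) then ∏ b, κ (u b) (o b) else 0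

variable {κ : U → O → ℝ} (hκ : ∀ u o, 0 ≤ κ u o) (φ : O → U)
include hκ

theorem tailErrorProb_le_prod {a : ℝ} (ha : 1 ≤ a) (r : ℝ) {n : ℕ} (u : Fin n → U) :
    tailErrorProb κ φ r u ≤
      a ^ (-r) * ∏ b, ∑ o, (if φ o ≠ u b then a else 1) * κ (u b) o := by
  have ha0 : 0 < a := one_pos.trans_le ha
  rw [Fintype.prod_sum, Finset.mul_sum]
  refine Finset.sum_le_sum fun o _ => ?_
  have hprod : 0 ≤ ∏ b, κ (u b) (o b) := Finset.prod_nonneg fun b _ => hκ _ _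
  rw [Finset.prod_mul_distrib, ← pow_hammingDist_eq_prod a (fun b => φ (o b)) u, ← mul_assoc,
    ← Real.rpow_natCast, ← Real.rpow_add ha0]
  split_ifs with h
  · exact le_mul_of_one_le_left hprod (Real.one_le_rpow ha (by linarith))
  · positivity

theorem expect_tailErrorProb_le [Fintype U] [Nonempty U] (hκ1 : ∀ u, ∑ o, κ u o = 1) {q : ℝ}
    (hq : 𝔼 u, ∑ o, (if φ o ≠ u then κ u o else 0) ≤ q) {a : ℝ} (ha : 1 ≤ a) (r : ℝ) (n : ℕ) :
    𝔼 u : Fin n → U, tailErrorProb κ φ r u ≤ a ^ (-r) * (1 + (a - 1) * q) ^ n := by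
  have weighted_eq (u : U) : ∑ o, (if φ o ≠ u then a else 1) * κ u o =
      1 + (a - 1) * ∑ o, (if φ o ≠ u then κ u o else 0) := by
    calc ∑ o, (if φ o ≠ u then a else 1) * κ u o
        = ∑ o, (κ u o + (a - 1) * if φ o ≠ u then κ u o else 0) :=
          Finset.sum_congr rfl fun o _ => by split_ifs <;> ring
      _ = 1 + (a - 1) * ∑ o, (if φ o ≠ u then κ u o else 0) := by
          rw [Finset.sum_add_distrib, hκ1, Finset.mul_sum]
  have error_nonneg (u : U) : 0 ≤ ∑ o, (if φ o ≠ u then κ u o else 0) :=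
    Finset.sum_nonneg fun o _ => by split_ifs <;> simp [hκ]
  have : 0 ≤ a - 1 := sub_nonneg.2 ha
  calc 𝔼 u : Fin n → U, tailErrorProb κ φ r u
      ≤ 𝔼 u : Fin n → U,
          a ^ (-r) * ∏ b, ∑ o, (if φ o ≠ u b then a else 1) * κ (u b) o :=
        Finset.expect_le_expect fun u _ => tailErrorProb_le_prod hκ φ ha r u
    _ = a ^ (-r) * (𝔼 u, ∑ o, (if φ o ≠ u then a else 1) * κ u o) ^ n := by
        rw [← Finset.mul_expect, Finset.expect_pow, Fintype.piFinset_univ]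
    _ = a ^ (-r) * (1 + (a - 1) * 𝔼 u, ∑ o, (if φ o ≠ u then κ u o else 0)) ^ n := by
        simp only [weighted_eq, Finset.expect_add_distrib, ← Finset.mul_expect,
          Fintype.expect_const]
    _ ≤ a ^ (-r) * (1 + (a - 1) * q) ^ n := by
        have : 0 ≤ 𝔼 u, ∑ o, (if φ o ≠ u then κ u o else 0) :=
          Finset.expect_nonneg fun u _ => error_nonneg u
        gcongr

end Averaging

section Blocks

variable {L N : ℕ}

/-- Cutting a sequence of length `L * N` into `L` consecutive blocks of length `N`. -/
def blocks {α : Type*} : (Fin (L * N) → α) ≃ (Fin L → Fin N → α) :=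
  (finProdFinEquiv.symm.arrowCongr (Equiv.refl α)).trans (Equiv.curry _ _ _)

theorem blocks_divNat_modNat {α : Type*} (a : Fin (L * N) → α) (n : Fin (L * N)) :
    blocks a n.divNat n.modNat = a n :=
  congrArg a (finProdFinEquiv.apply_symm_apply n)

theorem prod_divNat_modNat {A : Type*} [CommMonoid A] (a : Fin L → Fin N → A) :
    ∏ n : Fin (L * N), a n.divNat n.modNat = ∏ b, ∏ t, a b t :=
  (finProdFinEquiv.symm.prod_comp fun x : Fin L × Fin N => a x.1 x.2).trans
    (Fintype.prod_prod_type _)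

end Blocks

section Modulus

theorem exists_continuous_half_pow_le {e : ℕ → ℝ} (he : ∀ k, 0 < e k) :
    ∃ ζ : ℝ → ℝ, Continuous ζ ∧ ζ 0 = 0 ∧ ∀ k x, e k ≤ |x| → (1 / 2 : ℝ) ^ k ≤ ζ x := by
  let u (k : ℕ) (x : ℝ) : ℝ := (1 / 2) ^ k * min 1 (|x| / e k)
  have u_nonneg (k x) : 0 ≤ u k x := by
    have := he k
    positivity
  have u_le (k x) : u k x ≤ (1 / 2) ^ k := mul_le_of_le_one_right (by positivity) (min_le_left _ _)
  have summable_u (x) : Summable fun k => u k x :=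
    summable_geometric_two.of_nonneg_of_le (u_nonneg · x) (u_le · x)
  refine ⟨fun x => ∑' k, u k x, ?_, by simp [u], fun k x hx => ?_⟩
  · refine continuous_tsum (fun k => by fun_prop) summable_geometric_two fun k x => ?_
    rw [Real.norm_of_nonneg (u_nonneg k x)]
    exact u_le k x
  · calc (1 / 2 : ℝ) ^ k = u k x := by
          simp only [u, min_eq_left ((one_le_div (he k)).2 hx), mul_one]
      _ ≤ ∑' k, u k x := (summable_u x).le_tsum k fun k _ => u_nonneg k x

theorem exists_continuous_modulus {p : ℝ → ℝ → Prop} (hmono : ∀ x, Monotone (p x))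
    (hp : ∀ c, 0 < c → ∀ᶠ x in 𝓝[>] (0 : ℝ), p x c) :
    ∃ ζ : ℝ → ℝ, Continuous ζ ∧ ζ 0 = 0 ∧ ∀ᶠ x in 𝓝[>] (0 : ℝ), p x (ζ x) := by
  have threshold (k : ℕ) : ∃ e : ℝ, e ∈ Set.Ioc 0 ((1 / 2) ^ k) ∧
      Set.Ioo 0 e ⊆ {x | p x ((1 / 2) ^ k)} :=
    (mem_nhdsGT_iff_exists_mem_Ioc_Ioo_subset (by simp)).1 (hp _ (by positivity))
  choose e he hpe using threshold
  have exists_le {x : ℝ} (hx : 0 < x) : ∃ k, e (k + 1) ≤ x := by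
    obtain ⟨k, hk⟩ := exists_pow_lt_of_lt_one hx (one_half_lt_one (α := ℝ))
    exact ⟨k, (he (k + 1)).2.trans
      ((pow_le_pow_of_le_one (by norm_num) (by norm_num) k.le_succ).trans hk.le)⟩
  obtain ⟨ζ, hζ, hζ0, hle⟩ := exists_continuous_half_pow_le fun k => (he (k + 1)).1
  refine ⟨ζ, hζ, hζ0, ?_⟩
  filter_upwards [Ioo_mem_nhdsGT (he 0).1] with x ⟨hx, hx0⟩
  classical
  set k := Nat.find (exists_le hx)
  have hxk : x < e k := by
    rcases h : k with _ | j
    · exact hx0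
    · exact not_le.1 (Nat.find_min (exists_le hx) (by omega))
  exact hmono x (hle k x ((Nat.find_spec (exists_le hx)).trans (le_abs_self x))) (hpe k ⟨hx, hxk⟩)

end Modulus

namespace ICFB

variable (ch : ICFB) {M M' : Fin 3 → ℕ} {N L : ℕ}

/-- The conditional probability, given the messages `w`, of the block `s` of pairs formed by the
output triple and the feedback triple of each channel use. -/
noncomputable def condProb (f : ch.Encoder M N) (w : ∀ i, Fin (M i))
    (s : Fin N → (∀ i, ch.Y i) × (∀ i, ch.Z i)) : ℝ :=
  ∏ n, (ch.Q (ch.input f w (fun k => (s k).2) n) (s n).1 * ch.P (s n).1 (s n).2)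

/-- The message triple decoded from a block of outputs; the feedback part of the block is
ignored. -/
def decoded (g : ch.Decoder M N) (s : Fin N → (∀ i, ch.Y i) × (∀ i, ch.Z i)) : ∀ i, Fin (M i) :=
  fun i => g i fun n => (s n).1 i

theorem condProb_nonneg (f : ch.Encoder M N) (w : ∀ i, Fin (M i))
    (s : Fin N → (∀ i, ch.Y i) × (∀ i, ch.Z i)) : 0 ≤ ch.condProb f w s :=
  Finset.prod_nonneg fun _ _ => mul_nonneg (ch.Q_nonneg _ _) (ch.P_nonneg _ _)

theorem sum_condProb (f : ch.Encoder M N) (w : ∀ i, Fin (M i)) :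
    ∑ s, ch.condProb f w s = 1 := by
  refine sum_prod_eq_one_of_causal
    (fun n (h : Fin (n : ℕ) → (∀ i, ch.Y i) × (∀ i, ch.Z i)) t =>
      ch.Q (fun i => f i (w i) n fun k => (h k).2 i) t.1 * ch.P t.1 t.2) fun n h => ?_
  simp only [Fintype.sum_prod_type, ← Finset.mul_sum, ch.P_sum, mul_one, ch.Q_sum]

theorem errorProb_eq_expect (f : ch.Encoder M N) (g : ch.Decoder M N) :
    ch.errorProb f g =
      𝔼 w, ∑ s, if ch.decoded g s ≠ w then ch.condProb f w s else 0 := by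
  have uniform : ∏ i, (1 / (M i : ℝ)) = (Fintype.card (∀ i, Fin (M i)) : ℝ)⁻¹ := by
    simp [Fintype.card_pi]
  rw [Fintype.expect_eq_sum_div_card, div_eq_inv_mul, ← uniform, Finset.mul_sum, errorProb]
  refine Finset.sum_congr rfl fun w _ => ?_
  rw [← (Equiv.arrowProdEquivProdArrow (Fin N) (fun _ => ∀ i, ch.Y i)
    (fun _ => ∀ i, ch.Z i)).symm.sum_comp, Fintype.sum_prod_type, Finset.mul_sum]
  refine Finset.sum_congr rfl fun y _ => ?_
  rw [Finset.mul_sum]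
  refine Finset.sum_congr rfl fun z _ => ?_
  rw [mul_ite, mul_zero]
  congr

/-- The concatenation of the inner encoder `f` with the outer codebooks `c`: `f` is used in `L`
consecutive blocks, in block `b` with the `b`-th letters of the outer codewords as messages. Inside
a block, `f` is given the feedback of that block only. -/
def blockEncoder (f : ch.Encoder M N) (c : ∀ i, Fin (M' i) → Fin L → Fin (M i)) :
    ch.Encoder M' (L * N) :=
  fun i m n h => f i (c i m n.divNat) n.modNat fun k =>
    h ⟨k + N * n.divNat, (Nat.add_lt_add_right k.2 _).trans_eq (Nat.mod_add_div n N)⟩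

/-- The decoder that applies the inner decoder `g` to each of `L` blocks, and the outer decoders
`dec` to the sequences of results. -/
def blockDecoder (g : ch.Decoder M N) (dec : ∀ i, (Fin L → Fin (M i)) → Fin (M' i)) :
    ch.Decoder M' (L * N) :=
  fun i y => dec i fun b => g i (blocks y b)

theorem input_blockEncoder (f : ch.Encoder M N) (c : ∀ i, Fin (M' i) → Fin L → Fin (M i))
    (w : ∀ i, Fin (M' i)) (z : Fin (L * N) → ∀ i, ch.Z i) (n : Fin (L * N)) :
    ch.input (ch.blockEncoder f c) w z n =
      ch.input f (fun i => c i (w i) n.divNat) (blocks z n.divNat) n.modNat :=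
  rfl

theorem condProb_blockEncoder (f : ch.Encoder M N) (c : ∀ i, Fin (M' i) → Fin L → Fin (M i))
    (w : ∀ i, Fin (M' i)) (s : Fin (L * N) → (∀ i, ch.Y i) × (∀ i, ch.Z i)) :
    ch.condProb (ch.blockEncoder f c) w s =
      ∏ b, ch.condProb f (fun i => c i (w i) b) (blocks s b) := by
  simp only [condProb, ← prod_divNat_modNat, input_blockEncoder, blocks_divNat_modNat]
  rfl

theorem decoded_blockDecoder_eq {g : ch.Decoder M N} {r : ℝ}
    {c : ∀ i, Fin (M' i) → Fin L → Fin (M i)} {dec : ∀ i, (Fin L → Fin (M i)) → Fin (M' i)}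
    (hdec : ∀ i m v, (hammingDist v (c i m) : ℝ) < r → dec i v = m) {w : ∀ i, Fin (M' i)}
    {s : Fin (L * N) → (∀ i, ch.Y i) × (∀ i, ch.Z i)}
    (hs : (hammingDist (fun b => ch.decoded g (blocks s b)) (fun b i => c i (w i) b) : ℝ) < r) :
    ch.decoded (ch.blockDecoder g dec) s = w := by
  funext i
  refine hdec i (w i) _ (lt_of_le_of_lt ?_ hs)
  exact_mod_cast hammingDist_comp_le_hammingDist (fun _ u => u i)
    (x := fun b => ch.decoded g (blocks s b)) (y := fun b i => c i (w i) b)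

theorem exists_errorProb_blockEncoder_le (hM' : ∀ i, 0 < M' i) (f : ch.Encoder M N)
    (g : ch.Decoder M N) {r : ℝ} {c : ∀ i, Fin (M' i) → Fin L → Fin (M i)}
    (hc : ∀ i, Pairwise fun m m' => 2 * r ≤ (hammingDist (c i m) (c i m') : ℝ)) :
    ∃ g', ch.errorProb (ch.blockEncoder f c) g' ≤
      𝔼 w : ∀ i, Fin (M' i),
        tailErrorProb (ch.condProb f) (ch.decoded g) r fun b i => c i (w i) b := by
  have (i : Fin 3) : Nonempty (Fin (M' i)) := ⟨⟨0, hM' i⟩⟩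
  choose dec hdec using fun i => exists_nearest_codeword_decoder (hc i)
  refine ⟨ch.blockDecoder g dec, ?_⟩
  rw [errorProb_eq_expect]
  refine Finset.expect_le_expect fun w _ => ?_
  rw [tailErrorProb, ← blocks.sum_comp]
  refine Finset.sum_le_sum fun s _ => ?_
  rw [condProb_blockEncoder]
  have hnonneg : 0 ≤ ∏ b, ch.condProb f (fun i => c i (w i) b) (blocks s b) :=
    Finset.prod_nonneg fun b _ => ch.condProb_nonneg _ _ _
  split_ifs with hwrong hfar hfar
  · exact le_rfl
  · exact (hwrong (ch.decoded_blockDecoder_eq hdec (not_le.1 hfar))).elim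
  · exact hnonneg
  · exact le_rfl

theorem exists_errorProb_le_of_outer_code (hM : ∀ i, 0 < M i) (hM' : ∀ i, 0 < M' i)
    (f : ch.Encoder M N) (g : ch.Decoder M N) {q : ℝ} (hq : ch.errorProb f g ≤ q) {r : ℝ}
    {c : ∀ i, Fin (M' i) → Fin L → Fin (M i)}
    (hc : ∀ i, Pairwise fun m m' => 2 * r ≤ (hammingDist (c i m) (c i m') : ℝ)) :
    ∃ (f' : ch.Encoder M' (L * N)) (g' : ch.Decoder M' (L * N)),
      ch.errorProb f' g' ≤ 2 ^ (-r) * (1 + q) ^ L := by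
  have (i : Fin 3) : NeZero (M i) := ⟨(hM i).ne'⟩
  have (i : Fin 3) : NeZero (M' i) := ⟨(hM' i).ne'⟩
  -- Shifting the outer codebooks preserves distances, and a uniform shift makes the messages of the
  -- inner code uniform and independent from block to block, whatever the outer codewords are.
  obtain ⟨x, hx⟩ := exists_shift_expect_le
    (tailErrorProb (n := L) (ch.condProb f) (ch.decoded g) r)
    fun (w : ∀ i, Fin (M' i)) b i => c i (w i) b
  have hshift (i : Fin 3) : Pairwise fun m m' => 2 * r ≤
      (hammingDist (fun b => c i m b + x b i) (fun b => c i m' b + x b i) : ℝ) :=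
    fun m m' hne => by
      beta_reduce
      rw [hammingDist_comp (fun b => (· + x b i)) fun b => add_left_injective (x b i)]
      exact hc i hne
  obtain ⟨g', hg'⟩ := ch.exists_errorProb_blockEncoder_le hM' f g hshift
  refine ⟨_, g', (hg'.trans hx).trans ?_⟩
  have htwo : (2 : ℝ) - 1 = 1 := by norm_num
  simpa only [htwo, one_mul] using expect_tailErrorProb_le (ch.condProb_nonneg f) (ch.decoded g)
    (ch.sum_condProb f) (ch.errorProb_eq_expect f g ▸ hq) one_le_two r L

theorem mem_feedbackCapacity_of_code (hM : ∀ i, 0 < M i) (hN : 0 < N) (f : ch.Encoder M N)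
    (g : ch.Decoder M N) {η : ℝ} (hη : 0 < η) (hη4 : 4 * η ≤ 1) (herr : ch.errorProb f g ≤ η)
    {R : Fin 3 → ℝ}
    (hR : ∀ i, R i ≤ gilbertVarshamovRate (4 * η) (1 / (N : ℝ) * Real.logb 2 (M i))) :
    R ∈ ch.feedbackCapacity := by
  have (i : Fin 3) : Nonempty (Fin (M i)) := ⟨⟨0, hM i⟩⟩
  have hη4' : 0 < 4 * η := by positivity
  intro η' hη'
  obtain ⟨L, hLη', hL⟩ := (((tendsto_pow_atTop_nhds_zero_of_lt_one (by positivity)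
    (two_rpow_neg_two_mul_mul_one_add_lt_one hη)).eventually (ge_mem_nhds hη')).and
      (eventually_gt_atTop 0)).exists
  choose M' c hM' hc hrate using fun i =>
    exists_codebook_gilbertVarshamovRate_le (α := Fin (M i)) hη4' hη4 hL
  obtain ⟨f', g', herr'⟩ := ch.exists_errorProb_le_of_outer_code hM hM' f g herr
    (r := 2 * η * L) fun i m m' hne => (by ring : _ = 4 * η * L).trans_le (hc i hne)
  refine ⟨M', L * N, hM', Nat.mul_pos hL hN, Or.inl ⟨f', g', ?_, fun i => ?_⟩⟩
  · calc ch.errorProb f' g' ≤ 2 ^ (-(2 * η * L)) * (1 + η) ^ L := herr'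
      _ = (2 ^ (-(2 * η)) * (1 + η)) ^ L := by
          rw [mul_pow, ← Real.rpow_mul_natCast two_pos.le, neg_mul]
      _ ≤ η' := hLη'
  · have hN1 : 1 / (N : ℝ) ≤ 1 := div_le_one_of_le₀ (mod_cast hN) N.cast_nonneg
    have hrate' : gilbertVarshamovRate (4 * η) (Real.logb 2 (M i)) ≤
        1 / (L : ℝ) * Real.logb 2 (M' i) := by
      rw [one_div, le_inv_mul_iff₀ (mod_cast hL)]
      simpa using hrate i
    calc R i - η' ≤ R i := by linarith
      _ ≤ gilbertVarshamovRate (4 * η) (1 / (N : ℝ) * Real.logb 2 (M i)) := hR i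
      _ ≤ 1 / (N : ℝ) * gilbertVarshamovRate (4 * η) (Real.logb 2 (M i)) :=
          gilbertVarshamovRate_mul_le hη4'.le hη4 hN1 _
      _ ≤ 1 / (N : ℝ) * (1 / (L : ℝ) * Real.logb 2 (M' i)) := by gcongr
      _ = 1 / ((L * N : ℕ) : ℝ) * Real.logb 2 (M' i) := by
          push_cast
          field_simp

variable {ch}

theorem EpsAchievable.exists_code {η : ℝ} {R : Fin 3 → ℝ} (h : ch.EpsAchievable η R) :
    ∃ (M : Fin 3 → ℕ) (N : ℕ), (∀ i, 0 < M i) ∧ 0 < N ∧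
      ∃ (f : ch.Encoder M N) (g : ch.Decoder M N), ch.AchievableBy η R f g := by
  obtain ⟨M, N, hM, hN, h | ⟨μ, h⟩⟩ := h
  · exact ⟨M, N, hM, hN, h⟩
  · obtain ⟨f, hf⟩ := μ.support_nonempty
    exact ⟨M, N, hM, hN, f, h f hf⟩

theorem isLowerSet_feedbackCapacity : IsLowerSet ch.feedbackCapacity := by
  intro R R' hle hR η hη
  obtain ⟨M, N, hM, hN, f, g, herr, hrate⟩ := (hR η hη).exists_code
  exact ⟨M, N, hM, hN, Or.inl ⟨f, g, herr, fun i => by linarith [hrate i, hle i]⟩⟩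

/-- The transition probabilities of a channel with the alphabets of `ch`. -/
structure Law (ch : ICFB) where
  Q : (∀ i, ch.X i) → (∀ i, ch.Y i) → ℝ
  Q_nonneg : ∀ x y, 0 ≤ Q x y
  Q_sum : ∀ x, ∑ y, Q x y = 1
  P : (∀ i, ch.Y i) → (∀ i, ch.Z i) → ℝ
  P_nonneg : ∀ y z, 0 ≤ P y z
  P_sum : ∀ y, ∑ z, P y z = 1

/-- The channel with the alphabets of `ch` and the transition probabilities `law`. By definitional
unfolding, its codes are those of `ch`. -/
def withLaw (ch : ICFB) (law : ch.Law) : ICFB where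
  X := ch.X
  Y := ch.Y
  Z := ch.Z
  __ := law

variable {T : Type*} {l : Filter T} {law : T → ch.Law}
  (hQ : ∀ x y, Tendsto (fun t => (law t).Q x y) l (𝓝 (ch.Q x y)))
  (hP : ∀ y z, Tendsto (fun t => (law t).P y z) l (𝓝 (ch.P y z)))
include hQ hP

theorem tendsto_jointProb_withLaw {M : Fin 3 → ℕ} {N : ℕ} (f : ch.Encoder M N)
    (w : ∀ i, Fin (M i)) (y : Fin N → ∀ i, ch.Y i) (z : Fin N → ∀ i, ch.Z i) :
    Tendsto (fun t => (ch.withLaw (law t)).jointProb f w y z) l (𝓝 (ch.jointProb f w y z)) :=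
  (tendsto_finsetProd _ fun _ _ => (hQ _ _).mul (hP _ _)).const_mul _

theorem tendsto_errorProb_withLaw {M : Fin 3 → ℕ} {N : ℕ} (f : ch.Encoder M N)
    (g : ch.Decoder M N) :
    Tendsto (fun t => (ch.withLaw (law t)).errorProb f g) l (𝓝 (ch.errorProb f g)) := by
  classical
  have summand (w : ∀ i, Fin (M i)) (y : Fin N → ∀ i, ch.Y i) (z : Fin N → ∀ i, ch.Z i) :
      Tendsto (fun t => if (fun i => g i fun n => y n i) ≠ w then
          (ch.withLaw (law t)).jointProb f w y z else 0) l
        (𝓝 (if (fun i => g i fun n => y n i) ≠ w then ch.jointProb f w y z else 0)) := by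
    split_ifs
    · exact tendsto_jointProb_withLaw hQ hP f w y z
    · exact tendsto_const_nhds
  exact (tendsto_finsetSum Finset.univ fun w _ => tendsto_finsetSum Finset.univ fun y _ =>
    tendsto_finsetSum Finset.univ fun z _ => summand w y z :)

theorem eventually_sub_mem_feedbackCapacity_withLaw {R : Fin 3 → ℝ} (hR : R ∈ ch.feedbackCapacity)
    {c : ℝ} (hc : 0 < c) :
    ∀ᶠ t in l, (fun i => R i - c) ∈ (ch.withLaw (law t)).feedbackCapacity := by
  have rate_loss : ∀ᶠ η in 𝓝[>] (0 : ℝ), ∀ i, R i - c < gilbertVarshamovRate (4 * η) (R i - η) :=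
    eventually_all.2 fun i => eventually_lt_gilbertVarshamovRate (sub_lt_self _ hc)
  obtain ⟨η, hrate, hη, hη4⟩ := (rate_loss.and
    (Ioc_mem_nhdsGT (by norm_num : (0 : ℝ) < 1 / 4))).exists
  obtain ⟨M, N, hM, hN, f, g, herr, hcode⟩ := (hR (η / 2) (half_pos hη)).exists_code
  filter_upwards [(tendsto_errorProb_withLaw hQ hP f g).eventually
    (gt_mem_nhds (herr.trans_lt (half_lt_self hη)))] with t ht
  refine (ch.withLaw (law t)).mem_feedbackCapacity_of_code hM hN f g hη (by linarith) ht.le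
    fun i => (hrate i).le.trans (gilbertVarshamovRate_mono (by linarith) ?_)
  linarith [hcode i]

end ICFB

theorem lemma2_general {T : Type*} (ch : ICFB) (d : T → ℝ) (law : T → ch.Law)
    (hQ : ∀ x y, Tendsto (fun t => (law t).Q x y) (comap d (𝓝[>] 0)) (𝓝 (ch.Q x y)))
    (hP : ∀ y z, Tendsto (fun t => (law t).P y z) (comap d (𝓝[>] 0)) (𝓝 (ch.P y z)))
    {R : Fin 3 → ℝ} (hR : R ∈ ch.feedbackCapacity) :
    ∃ ζ : ℝ → ℝ, Continuous ζ ∧ Tendsto ζ (𝓝[>] 0) (𝓝 0) ∧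
      ∃ ε₀ : ℝ, 0 < ε₀ ∧ ∀ t, 0 < d t → d t < ε₀ →
        (fun i => R i - ζ (d t)) ∈ (ch.withLaw (law t)).feedbackCapacity := by
  obtain ⟨ζ, hζ, hζ0, hcap⟩ := exists_continuous_modulus
    (p := fun x c => ∀ t, d t = x → (fun i => R i - c) ∈ (ch.withLaw (law t)).feedbackCapacity)
    (fun x c c' hcc' hc t ht => ICFB.isLowerSet_feedbackCapacity
      (fun i => sub_le_sub_left hcc' (R i)) (hc t ht))
    fun c hc => eventually_comap.1 <|
      ICFB.eventually_sub_mem_feedbackCapacity_withLaw hQ hP hR hc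
  obtain ⟨ε₀, hε₀, hball⟩ := mem_nhdsGT_iff_exists_Ioo_subset.1 hcap
  exact ⟨ζ, hζ, (hζ.tendsto' 0 0 hζ0).mono_left nhdsWithin_le_nhds, ε₀, hε₀,
    fun t h0 h1 => hball ⟨h0, h1⟩ t rfl⟩

namespace Example1

/-- The transition probabilities of `channel p δ ε`, as a perturbation of `channel p δ 0`. -/
noncomputable def channelLaw (p δ ε : unitInterval) : (channel p δ 0).Law :=
  { channel p δ ε with }

theorem continuous_bern (b : Bool) : Continuous fun q : ℝ => bern q b := by
  cases b <;> simp only [bern, Bool.false_eq_true, if_true, if_false] <;> fun_prop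

theorem continuous_channel_Q (p δ : unitInterval) (x : ∀ i, In i) (y : ∀ i, Out i) :
    Continuous fun ε : unitInterval => (channel p δ ε).Q x y := by
  have hbern (b : Bool) : Continuous fun ε : unitInterval => bern ε b :=
    (continuous_bern b).comp continuous_subtype_val
  classical
  change Continuous fun ε : unitInterval =>
    ∑ v : Noise, if output x v = y then noiseProb p δ ε v else 0
  refine continuous_finsetSum _ fun v _ => ?_
  split_ifs
  · unfold noiseProb
    fun_prop
  · exact continuous_const

theorem tendsto_channelLaw_Q (p δ : unitInterval) (x : ∀ i, In i) (y : ∀ i, Out i) :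
    Tendsto (fun ε => (channelLaw p δ ε).Q x y) (comap (Subtype.val : unitInterval → ℝ) (𝓝[>] 0))
      (𝓝 ((channel p δ 0).Q x y)) := by
  refine ((continuous_channel_Q p δ x y).tendsto 0).mono_left ?_
  rw [nhds_subtype]
  exact comap_mono nhdsWithin_le_nhds

end Example1

theorem lemma2 (p δ : unitInterval) (R : Fin 3 → ℝ)
    (hR : R ∈ (Example1.channel p δ 0).feedbackCapacity) :
    ∃ ζ : ℝ → ℝ, Continuous ζ ∧ Tendsto ζ (𝓝[>] 0) (𝓝 0) ∧
      ∃ ε₀ : ℝ, 0 < ε₀ ∧ ∀ ε : unitInterval, 0 < (ε : ℝ) → (ε : ℝ) < ε₀ →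
        (fun i => R i - ζ ε) ∈ (Example1.channel p δ ε).feedbackCapacity :=
  lemma2_general (Example1.channel p δ 0) Subtype.val (Example1.channelLaw p δ)
    (Example1.tendsto_channelLaw_Q p δ) (fun _ _ => tendsto_const_nhds) hR
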